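/- Let $\|\cdot\|$ be a norm on $\mathbb{R}^d$ that is smooth, i.e. the function $x\mapsto\|x\|$ is differentiable at every $x\neq 0$, and rotund (strictly convex), i.e. $\bigl\|\tfrac{x+y}{2}\bigr\|<1$ for all $x\neq y$ with $\|x\|=\|y\|=1$. For $C,D\subseteq\mathbb{R}^d$ put $\mathrm{dist}(C,D)=\inf\{\|x-y\| : x\in C,\ y\in D\}\in[0,+\infty]$ (so the distance to the empty set is $+\infty$), and write $\mathrm{dist}(x,D)$ for $\mathrm{dist}(\{x\},D)$. Let $(P_1,\dots,P_n)$ be an $n$-tuple of nonempty closed subsets of $\mathbb{R}^d$ (the sites) such that $\mathrm{dist}(P_i,P_j)>0$ for all $i\neq j$. Then this tuple has exactly one zone diagram: there is exactly one $n$-tuple $(R_1,\dots,R_n)$ of subsets of $\mathbb{R}^d$ such that, for every $i=1,\dots,n$, $$R_i=\Bigl\{x\in\mathbb{R}^d : \mathrm{dist}(x,P_i)\le \mathrm{dist}\Bigl(x,\bigcup_{j\neq i}R_j\Bigr)\Bigr\}.$$ Equivalently, the dominance map $\mathrm{Dom}$, which sends a tuple $(R_1,\dots,R_n)$ to the tuple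 whose $i$-th entry is the right-hand side above, has exactly one fixed point. -/

import Mathlib

/-- The distance `inf {dist x y : x ∈ C, y ∈ D}` of two sets, with values in `[0, +∞]`
(it is `+∞` if one of the sets is empty). -/
noncomputable def setEDist {X : Type*} [MetricSpace X] (C D : Set X) : ENNReal :=
  ⨅ x ∈ C, ⨅ y ∈ D, edist x y

/-- The dominance region of `A` over `B`: the points `x` with `dist(x, A) ≤ dist(x, B)`.
`Metric.infEDist x A` is the distance of `x` to `A` with values in `[0, +∞]`,
so that the distance to the empty set is `+∞`. -/
def dominanceRegion {X : Type*} [MetricSpace X] (A B : Set X) : Set X :=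
  {x | Metric.infEDist x A ≤ Metric.infEDist x B}

/-- The dominance map of the tuple `P` of sites. -/
def Dom {X : Type*} [MetricSpace X] {n : ℕ} (P R : Fin n → Set X) : Fin n → Set X :=
  fun i => dominanceRegion (P i) (⋃ (j : Fin n) (_ : j ≠ i), R j)

/-- `R` is a zone diagram of the tuple `P` of sites. -/
def IsZoneDiagram {X : Type*} [MetricSpace X] {n : ℕ} (P R : Fin n → Set X) : Prop :=
  R = Dom P R

/-- The norm of `E` is smooth: it is differentiable at every point other than the origin
(no norm is differentiable at the origin of a nonzero space). -/
def IsSmoothNorm (E : Type*) [NormedAddCommGroup E] [NormedSpace ℝ E] : Prop :=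
  ∀ x : E, x ≠ 0 → DifferentiableAt ℝ (fun y : E => ‖y‖) x

/-! `Dom` is antitone, so its square is monotone and has a least fixed point `R`. With `S = Dom P
R`, the two tuples are interchanged by `Dom` and `R ≤ S`. If `R = S`, this is a zone diagram, and
any other one contains `R` by leastness and lies below `Dom P R = R` by antitonicity.

To exclude `R ≠ S`, let `m > 0` be the infimum of the distances from points of `S i \ R i` to their
sites. From a nearly minimal such point `a`, `exists_gap_expansion` finds another one, `b`, in some
`S j \ R j`, whose distance to `R j` exceeds that of `a` to `R i` by a fixed factor `q > 1`.
Iteration is absurd, since these distances stay at most `m + t`.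

To find `b`, walk from a nearest site point `p` towards `a` until just after the last point of `R
i`; some `b` in `S j` obstructs there. Rotundity puts balls around the earlier points of the walk
inside `R i`. They keep `b` away, so the distance to `b` falls along the walk at a definite rate.
Smoothness carries the fall on up to `a`. Thus `b` is close to `a`, while `R j` is not. -/

open Metric in
theorem mem_Dom_iff {X : Type*} [MetricSpace X] {n : ℕ} {P R : Fin n → Set X}
    (hne : ∀ i, (P i).Nonempty) {i : Fin n} {x : X} :
    x ∈ Dom P R i ↔ ∀ j, j ≠ i → ∀ y ∈ R j, infDist x (P i) ≤ dist x y := by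
  have h : infEDist x (P i) = ENNReal.ofReal (infDist x (P i)) :=
    (ENNReal.ofReal_toReal (infEDist_ne_top (hne i))).symm
  simp only [Dom, dominanceRegion, Set.mem_ofPred_eq, le_infEDist, Set.mem_iUnion, h, edist_dist]
  constructor
  · intro H j hj y hy
    exact (ENNReal.ofReal_le_ofReal_iff dist_nonneg).1 (H y ⟨j, hj, hy⟩)
  · rintro H y ⟨j, hj, hy⟩
    exact (ENNReal.ofReal_le_ofReal_iff dist_nonneg).2 (H j hj y hy)

theorem Dom_antitone {X : Type*} [MetricSpace X] {n : ℕ} (P : Fin n → Set X) :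
    Antitone (Dom P) := by
  intro R S h i x hx
  refine le_trans (show _ ≤ _ from hx) (Metric.infEDist_anti ?_)
  exact Set.iUnion_mono fun j => Set.iUnion_mono fun _ => h j

/-- A positive lower bound for the distances between the points of different sites. -/
theorem exists_pos_le_dist_of_setEDist_pos {X : Type*} [MetricSpace X] {n : ℕ}
    {P : Fin n → Set X} (hdist : ∀ i j, i ≠ j → 0 < setEDist (P i) (P j)) :
    ∃ e : ℝ, 0 < e ∧ ∀ i j, i ≠ j → ∀ x ∈ P i, ∀ y ∈ P j, e ≤ dist x y := by
  have h : ∀ᶠ e : ℝ in nhdsWithin 0 (Set.Ioi 0),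
      ∀ i j, i ≠ j → ENNReal.ofReal e < setEDist (P i) (P j) := by
    rw [Filter.eventually_all]
    intro i
    rw [Filter.eventually_all]
    intro j
    by_cases hij : i = j
    · simp [hij]
    · have h1 : Filter.Tendsto ENNReal.ofReal (nhdsWithin 0 (Set.Ioi 0)) (nhds 0) := by
        have := (ENNReal.continuous_ofReal.tendsto 0).mono_left
          (nhdsWithin_le_nhds (s := Set.Ioi (0 : ℝ)))
        simpa using this
      filter_upwards [h1.eventually (gt_mem_nhds (hdist i j hij))] with e he _ using he
  obtain ⟨e, he, hpos⟩ := (h.and self_mem_nhdsWithin).exists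
  refine ⟨e, hpos, fun i j hij x hx y hy => ?_⟩
  have h2 : setEDist (P i) (P j) ≤ edist x y := iInf₂_le_of_le x hx (iInf₂_le y hy)
  have h3 := (he i j hij).le.trans h2
  rw [edist_dist] at h3
  exact (ENNReal.ofReal_le_ofReal_iff dist_nonneg).1 h3

theorem convexOn_norm_add_smul {E : Type*} [NormedAddCommGroup E] [NormedSpace ℝ E] (x w : E) :
    ConvexOn ℝ Set.univ fun t : ℝ => ‖x + t • w‖ := by
  refine ⟨convex_univ, fun s _ t _ a b ha hb hab => ?_⟩
  have : x + (a • s + b • t) • w = a • (x + s • w) + b • (x + t • w) := by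
    have : x = (a + b) • x := by rw [hab, one_smul]
    conv_lhs => rw [this]
    simp only [smul_eq_mul]
    module
  simp only [this]
  refine (norm_add_le _ _).trans ?_
  rw [norm_smul, norm_smul, Real.norm_of_nonneg ha, Real.norm_of_nonneg hb, smul_eq_mul,
    smul_eq_mul]

/-! ### Uniform convexity and smoothness by compactness -/

section Norm

variable {E : Type*} [NormedAddCommGroup E] [NormedSpace ℝ E] [FiniteDimensional ℝ E]

/-- A strictly convex norm in finite dimension is uniformly convex. -/
theorem exists_norm_add_le_two_mul_max_sub [StrictConvexSpace ℝ E] {e : ℝ} (he : 0 < e) (M : ℝ) :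
    ∃ δ : ℝ, 0 < δ ∧ ∀ x y : E, ‖x‖ ≤ M → ‖y‖ ≤ M → e ≤ ‖x - y‖ →
      ‖x + y‖ ≤ 2 * max ‖x‖ ‖y‖ - δ := by
  have : ProperSpace E := FiniteDimensional.proper_real E
  set K : Set (E × E) :=
    (Metric.closedBall 0 M ×ˢ Metric.closedBall 0 M) ∩ {z | e ≤ ‖z.1 - z.2‖}
  have hK : IsCompact K :=
    ((isCompact_closedBall _ _).prod (isCompact_closedBall _ _)).inter_right
      (isClosed_le continuous_const (by fun_prop))
  have hcont : Continuous fun z : E × E => 2 * max ‖z.1‖ ‖z.2‖ - ‖z.1 + z.2‖ := by fun_prop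
  have hpos : ∀ z ∈ K, 0 < 2 * max ‖z.1‖ ‖z.2‖ - ‖z.1 + z.2‖ := by
    rintro ⟨x, y⟩ ⟨-, hz⟩
    simp only [Set.mem_ofPred_eq] at hz
    have hxy : x ≠ y := by
      rintro rfl
      simp at hz
      linarith
    have h1 := norm_add_le x y
    have h2 := le_max_left ‖x‖ ‖y‖
    have h3 := le_max_right ‖x‖ ‖y‖
    by_contra hcon
    simp only [not_lt] at hcon
    have h4 : ‖x + y‖ = ‖x‖ + ‖y‖ := by linarith
    have h5 : ‖x‖ = ‖y‖ := by linarith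
    exact hxy ((sameRay_iff_norm_add.2 h4).eq_of_norm_eq h5)
  rcases K.eq_empty_or_nonempty with hemp | hne
  · refine ⟨1, one_pos, fun x y hx hy hxy => absurd (show (x, y) ∈ K from ?_) (by simp [hemp])⟩
    exact ⟨⟨by simpa using hx, by simpa using hy⟩, hxy⟩
  · obtain ⟨z, hz, hmin⟩ := hK.exists_isMinOn hne hcont.continuousOn
    refine ⟨_, hpos z hz, fun x y hx hy hxy => ?_⟩
    have := hmin (show (x, y) ∈ K from ⟨⟨by simpa using hx, by simpa using hy⟩, hxy⟩)
    simp only [Set.mem_ofPred_eq] at this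
    linarith

/-- Moving from the centre of a ball towards a point `w` of the sphere increases the clearance
of the shrinking ball to the exterior points that stay away from `w`. -/
theorem exists_clearance_le_norm_sub_smul [StrictConvexSpace ℝ E] {e M : ℝ} (he : 0 < e)
    (hM : 0 < M) :
    ∃ c : ℝ, 0 < c ∧ c ≤ 1 / 4 ∧ ∀ (L σ : ℝ) (v w : E), 0 < L → L ≤ M → 0 ≤ σ → σ ≤ 1 / 2 →
      L ≤ ‖v‖ → ‖w‖ ≤ L → e ≤ ‖v - w‖ → (1 - σ) * L + 2 * c * (σ * L) ≤ ‖v - σ • w‖ := by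
  obtain ⟨δ, hδ, H⟩ := exists_norm_add_le_two_mul_max_sub (E := E) he (2 * M)
  refine ⟨min (1 / 4) (δ / (8 * M)), by positivity, min_le_left _ _, ?_⟩
  intro L σ v w hL hLM hσ hσ2 hv hw hvw
  set c := min (1 / 4) (δ / (8 * M)) with hc
  have hc0 : 0 < c := by positivity
  have hc1 : c ≤ 1 / 4 := min_le_left _ _
  have hc2 : c * (8 * M) ≤ δ := by
    rw [← le_div_iff₀ (by positivity)]
    exact min_le_right _ _
  by_contra! hcon
  rcases hσ.eq_or_lt with rfl | hσ0
  · simp at hcon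
    linarith
  have hs : 0 < 1 - σ := by linarith
  -- `v` lies on the segment from `X` to `w`. Failure of the bound makes `‖X‖` barely exceed `L`,
  -- and uniform convexity then forces `‖v‖ < L`.
  set X := (1 - σ)⁻¹ • (v - σ • w) with hX
  have hXv : (1 - σ) • X = v - σ • w := smul_inv_smul₀ hs.ne' _
  have hσL : 0 < σ * L := by positivity
  have hcσ : 0 < c * (σ * L) := by positivity
  set K := L + 4 * c * (σ * L) with hK
  have hXK : ‖X‖ ≤ K := by
    rw [hX, norm_smul, norm_inv, Real.norm_of_nonneg hs.le, inv_mul_le_iff₀ hs]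
    nlinarith
  have hwK : ‖w‖ ≤ K := by linarith
  have hKM : K ≤ 2 * M := by nlinarith
  have hXw : e ≤ ‖X - w‖ := by
    have h1 : (1 - σ) • (X - w) = v - w := by
      rw [smul_sub, hXv]
      module
    have h2 : (1 - σ) * ‖X - w‖ = ‖v - w‖ := by
      rw [← h1, norm_smul, Real.norm_of_nonneg hs.le]
    nlinarith [norm_nonneg (X - w)]
  have hsum : ‖X + w‖ ≤ 2 * K - δ := by
    have := H X w (hXK.trans hKM) (hwK.trans hKM) hXw
    linarith [max_le hXK hwK]
  have hveq : v = (1 - 2 * σ) • X + σ • (X + w) := by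
    have : v = (1 - σ) • X + σ • w := by
      rw [hXv]
      module
    rw [this]
    module
  have hvle : ‖v‖ ≤ (1 - 2 * σ) * ‖X‖ + σ * ‖X + w‖ := by
    conv_lhs => rw [hveq]
    refine (norm_add_le _ _).trans ?_
    rw [norm_smul (1 - 2 * σ) X, norm_smul σ, Real.norm_of_nonneg hσ,
      Real.norm_of_nonneg (by linarith : (0 : ℝ) ≤ 1 - 2 * σ)]
  have h1 : (1 - 2 * σ) * ‖X‖ ≤ (1 - 2 * σ) * K :=
    mul_le_mul_of_nonneg_left hXK (by linarith)
  have h2 : σ * ‖X + w‖ ≤ σ * (2 * K - δ) := mul_le_mul_of_nonneg_left hsum hσ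
  have h3 : L ≤ K - σ * δ := by linarith
  have h4 : σ * δ ≤ 4 * c * (σ * L) := by linarith
  have h5 : δ ≤ 4 * c * L := by
    have : σ * δ ≤ σ * (4 * c * L) := by linarith
    exact le_of_mul_le_mul_left this hσ0
  nlinarith

/-- A smooth norm in finite dimension is uniformly smooth away from the origin. -/
theorem exists_norm_add_norm_sub_le (hsmooth : IsSmoothNorm E) {r c K : ℝ} (hr : 0 < r)
    (hc : 0 < c) (hK : 0 < K) (M : ℝ) :
    ∃ κ : ℝ, 0 < κ ∧ κ < K ∧ ∀ x w : E, r ≤ ‖x‖ → ‖x‖ ≤ M → ‖w‖ ≤ 1 →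
      ‖x + κ • w‖ + ‖x - κ • w‖ ≤ 2 * ‖x‖ + c * κ := by
  have : ProperSpace E := FiniteDimensional.proper_real E
  set C : Set (E × E) := (Metric.closedBall 0 M ×ˢ Metric.closedBall 0 1) ∩ {z | r ≤ ‖z.1‖}
  have hC : IsCompact C :=
    ((isCompact_closedBall _ _).prod (isCompact_closedBall _ _)).inter_right
      (isClosed_le continuous_const (by fun_prop))
  -- Quantifying over all `t ≤ κ` makes the property stable under unions, by taking the smaller `κ`.
  have key : ∃ κ : ℝ, 0 < κ ∧ κ < K ∧ ∀ z ∈ C, ∀ t, 0 < t → t ≤ κ →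
      ‖z.1 + t • z.2‖ + ‖z.1 - t • z.2‖ ≤ 2 * ‖z.1‖ + c * t := by
    refine hC.induction_on (p := fun A => ∃ κ : ℝ, 0 < κ ∧ κ < K ∧ ∀ z ∈ A, ∀ t, 0 < t → t ≤ κ →
      ‖z.1 + t • z.2‖ + ‖z.1 - t • z.2‖ ≤ 2 * ‖z.1‖ + c * t) ?_ ?_ ?_ ?_
    · exact ⟨K / 2, by linarith, by linarith, by simp⟩
    · rintro A B hAB ⟨κ, h0, h1, h2⟩
      exact ⟨κ, h0, h1, fun z hz => h2 z (hAB hz)⟩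
    · rintro A B ⟨κ, h0, h1, h2⟩ ⟨κ', h0', h1', h2'⟩
      refine ⟨min κ κ', lt_min h0 h0', (min_le_left _ _).trans_lt h1, ?_⟩
      rintro z (hz | hz) t ht htκ
      · exact h2 z hz t ht (htκ.trans (min_le_left _ _))
      · exact h2' z hz t ht (htκ.trans (min_le_right _ _))
    · rintro ⟨x, w⟩ ⟨-, hx⟩
      have hx0 : x ≠ 0 := by
        rintro rfl
        simp at hx
        linarith
      have hd := (hsmooth x hx0).hasFDerivAt
      set f' := fderiv ℝ (fun y : E => ‖y‖) x
      have hline (u : E) : HasDerivAt (fun t : ℝ => ‖x + t • u‖) (f' u) 0 := by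
        have h1 : HasDerivAt (fun t : ℝ => x + t • u) u 0 := by
          simpa using ((hasDerivAt_id (0 : ℝ)).smul_const u).const_add x
        have h2 : HasFDerivAt (fun y : E => ‖y‖) f' (x + (0 : ℝ) • u) := by simpa using hd
        exact h2.comp_hasDerivAt 0 h1
      have hφ : HasDerivAt (fun t : ℝ => ‖x + t • w‖ + ‖x + t • (-w)‖) 0 0 := by
        have h := (hline w).add (hline (-w))
        rwa [map_neg, add_neg_cancel] at h
      have hev := (hasDerivAt_iff_isLittleO.1 hφ).def (show 0 < c / 2 by linarith)
      obtain ⟨ρ, hρ, hball⟩ := Metric.eventually_nhds_iff.1 hev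
      set τ := min (ρ / 2) (K / 2) with hτ
      have hτ0 : 0 < τ := by positivity
      have hτρ : τ < ρ := (min_le_left _ _).trans_lt (by linarith)
      have hτK : τ < K := (min_le_right _ _).trans_lt (by linarith)
      have hlt : ‖x + τ • w‖ + ‖x - τ • w‖ < 2 * ‖x‖ + c * τ := by
        have := hball (show dist τ 0 < ρ by simpa [abs_of_pos hτ0] using hτρ)
        simp only [zero_smul, add_zero, smul_zero, sub_zero, smul_neg, ← sub_eq_add_neg,
          Real.norm_eq_abs, abs_of_pos hτ0] at this
        have := (le_abs_self _).trans this
        nlinarith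
      have hopen : ∀ᶠ z : E × E in nhds (x, w),
          ‖z.1 + τ • z.2‖ + ‖z.1 - τ • z.2‖ < 2 * ‖z.1‖ + c * τ := by
        refine (isOpen_lt ?_ ?_).mem_nhds hlt
        · fun_prop
        · fun_prop
      refine ⟨_, mem_nhdsWithin_of_mem_nhds hopen, τ, hτ0, hτK, ?_⟩
      rintro ⟨y, u⟩ hz t ht htτ
      simp only [Set.mem_ofPred_eq] at hz ⊢
      -- Convexity passes the bound from the single step `τ`, where it is an open condition, to all
      -- shorter steps.
      have hscale (u : E) : ‖y + t • u‖ ≤ (1 - t / τ) * ‖y‖ + t / τ * ‖y + τ • u‖ := by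
        have h1 : t / τ ≤ 1 := (div_le_one hτ0).2 htτ
        have h2 : 0 ≤ t / τ := by positivity
        have := (convexOn_norm_add_smul y u).2 (Set.mem_univ 0) (Set.mem_univ τ)
          (sub_nonneg.2 h1) h2 (by ring)
        simpa [div_mul_cancel₀ _ hτ0.ne'] using this
      have h1 := hscale u
      have h2 := hscale (-u)
      simp only [smul_neg, ← sub_eq_add_neg] at h2
      have h3 : t / τ * (‖y + τ • u‖ + ‖y - τ • u‖) ≤ t / τ * (2 * ‖y‖ + c * τ) :=
        mul_le_mul_of_nonneg_left hz.le (by positivity)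
      have h4 : t / τ * (c * τ) = c * t := by field_simp
      linarith
  obtain ⟨κ, h0, h1, h2⟩ := key
  refine ⟨κ, h0, h1, fun x w hx hxM hw => h2 (x, w) ⟨⟨?_, ?_⟩, hx⟩ κ h0 le_rfl⟩
  · simpa using hxM
  · simpa using hw

end Norm

open Metric

/-! ### The expansion argument -/

section DoubleZoneDiagram

variable {E : Type*} [NormedAddCommGroup E] [NormedSpace ℝ E]

/-- The point at distance `L - s` from `a` in the direction opposite to `w`. -/
def retreat (a w : E) (L s : ℝ) : E := a - (L - s) • w

theorem dist_retreat {w : E} (hw : ‖w‖ = 1) (a : E) (L s t : ℝ) :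
    dist (retreat a w L s) (retreat a w L t) = |s - t| := by
  have : retreat a w L s - retreat a w L t = (s - t) • w := by
    simp only [retreat]
    module
  rw [dist_eq_norm, this, norm_smul, hw, mul_one, Real.norm_eq_abs]

theorem retreat_self (a w : E) (L : ℝ) : retreat a w L L = a := by simp [retreat]

theorem continuous_retreat (a w : E) (L : ℝ) : Continuous (retreat a w L) := by
  unfold retreat
  fun_prop

/-- A ball around a point contains a point that is nearer to `b` by the radius. -/
theorem exists_dist_add_eq {x b : E} {ρ : ℝ} (hρ : 0 ≤ ρ) (h : ρ ≤ dist b x) :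
    ∃ z, dist z x ≤ ρ ∧ dist b z = dist b x - ρ := by
  rcases eq_or_ne b x with rfl | hbx
  · have : ρ = 0 := le_antisymm (by simpa using h) hρ
    exact ⟨b, by simp [this], by simp [this]⟩
  have hd : 0 < dist b x := dist_pos.2 hbx
  have hq : ρ / dist b x ≤ 1 := (div_le_one hd).2 h
  have hq0 : 0 ≤ ρ / dist b x := by positivity
  refine ⟨AffineMap.lineMap x b (ρ / dist b x), ?_, ?_⟩
  · rw [dist_lineMap_left, Real.norm_of_nonneg hq0, dist_comm x b, div_mul_cancel₀ _ hd.ne']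
  · rw [dist_comm b, dist_lineMap_right, Real.norm_of_nonneg (sub_nonneg.2 hq), dist_comm x b,
      sub_mul, one_mul, div_mul_cancel₀ _ hd.ne']

/-- The right slope of a convex function of the form `‖x + t • w‖` is controlled by its left slope
and the second difference. -/
theorem norm_add_smul_le_of_second_difference {x w : E} {κ η α h : ℝ} (hκ : 0 < κ) (hh : 0 ≤ h)
    (hhκ : h ≤ κ) (h2 : ‖x + κ • w‖ + ‖x - κ • w‖ ≤ 2 * ‖x‖ + η * κ)
    (hleft : ‖x‖ + α * κ ≤ ‖x - κ • w‖) : ‖x + h • w‖ ≤ ‖x‖ - (α - η) * h := by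
  have h1 : h / κ ≤ 1 := (div_le_one hκ).2 hhκ
  have h0 : 0 ≤ h / κ := by positivity
  have hconv := (convexOn_norm_add_smul x w).2 (Set.mem_univ 0) (Set.mem_univ κ)
    (sub_nonneg.2 h1) h0 (by ring)
  simp only [smul_eq_mul, mul_zero, zero_add, div_mul_cancel₀ _ hκ.ne', zero_smul,
    add_zero] at hconv
  have h3 : h / κ * ‖x + κ • w‖ ≤ h / κ * (‖x‖ - (α - η) * κ) :=
    mul_le_mul_of_nonneg_left (by linarith) h0
  have h4 : h / κ * ((α - η) * κ) = (α - η) * h := by field_simp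
  linarith

variable [FiniteDimensional ℝ E] {n : ℕ} {P R S : Fin n → Set E}

/-- If `m` is a lower bound for the distance of the points of `S i \ R i` to their site, then
from every such point that nearly attains the bound one passes to another one
whose distance to the inner region is larger by a constant factor. -/
theorem exists_gap_expansion [StrictConvexSpace ℝ E] (hsmooth : IsSmoothNorm E)
    (hne : ∀ i, (P i).Nonempty) (hclosed : ∀ i, IsClosed (P i))
    (hR : ∀ i x, x ∈ R i ↔ ∀ j, j ≠ i → ∀ y ∈ S j, infDist x (P i) ≤ dist x y)
    (hS : ∀ i x, x ∈ S i ↔ ∀ j, j ≠ i → ∀ y ∈ R j, infDist x (P i) ≤ dist x y)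
    (hRS : ∀ i, R i ⊆ S i) (hPR : ∀ i, P i ⊆ R i) (hRc : ∀ i, IsClosed (R i))
    {e m : ℝ} (he : 0 < e) (hm : 0 < m)
    (hsep : ∀ i j, j ≠ i → ∀ x ∈ P i, ∀ y ∈ S j, e ≤ dist x y)
    (hgap : ∀ i, ∀ x ∈ S i, x ∉ R i → m ≤ infDist x (P i)) :
    ∃ t q : ℝ, 0 < t ∧ 1 < q ∧ ∀ i, ∀ a ∈ S i, a ∉ R i → infDist a (P i) ≤ m + t →
      ∃ j, ∃ b ∈ S j, b ∉ R j ∧ infDist b (P j) ≤ m + t ∧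
        q * infDist a (R i) ≤ infDist b (R j) := by
  have : ProperSpace E := FiniteDimensional.proper_real E
  obtain ⟨c, hc, hc4, hcone⟩ :=
    exists_clearance_le_norm_sub_smul (E := E) he (show 0 < m + 1 by linarith)
  obtain ⟨κ, hκ, hκK, hκs⟩ := exists_norm_add_norm_sub_le hsmooth (half_pos hm)
    (show 0 < c / 4 by linarith) (show 0 < min (m / 4) 1 by positivity) (m + 1)
  have hκm : κ < m / 4 := hκK.trans_le (min_le_left _ _)
  have hκ1 : κ < 1 := hκK.trans_le (min_le_right _ _)
  have hcκ : 0 < c * κ := by positivity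
  have hcκ4 : c * κ ≤ κ / 4 := by nlinarith
  refine ⟨c * κ / 2, 1 + c / 8, by linarith, by linarith, ?_⟩
  intro i a haS haR haD
  set L := infDist a (P i) with hL
  have hmL : m ≤ L := hgap i a haS haR
  have hL0 : 0 < L := hm.trans_le hmL
  obtain ⟨p, hp, hap⟩ := (hclosed i).exists_infDist_eq_dist (hne i) a
  rw [← hL] at hap
  set w := L⁻¹ • (a - p) with hw
  have hLw : L • w = a - p := smul_inv_smul₀ hL0.ne' _
  have hw1 : ‖w‖ = 1 := by
    rw [hw, norm_smul, norm_inv, Real.norm_of_nonneg hL0.le, ← dist_eq_norm, ← hap,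
      inv_mul_cancel₀ hL0.ne']
  set A := retreat a w L with hA
  have hAL : A L = a := retreat_self a w L
  have hA0 : A 0 = p := by simp [hA, retreat, hLw]
  have hAdist (s t : ℝ) : dist (A s) (A t) = |s - t| := dist_retreat hw1 a L s t
  have hAD {s : ℝ} (hs : 0 ≤ s) : infDist (A s) (P i) ≤ s := by
    refine (infDist_le_dist_of_mem hp).trans_eq ?_
    rw [← hA0, hAdist, sub_zero, abs_of_nonneg hs]
  have hAS {s : ℝ} (hs : 0 ≤ s) (hsL : s ≤ L) : A s ∈ S i := by
    refine (hS i _).2 fun j hj y hy => (hAD hs).trans ?_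
    have h1 := (hS i a).1 haS j hj y hy
    have h2 := dist_triangle a (A s) y
    have h3 : dist a (A s) = L - s := by
      rw [← hAL, hAdist, abs_of_nonneg (by linarith)]
    linarith
  have hlow {z : E} (hz : z ∈ S i) (hzm : infDist z (P i) < m) : z ∈ R i := by
    by_contra hzR
    exact absurd (hgap i z hz hzR) (not_le.2 hzm)
  -- The other regions avoid the open ball of radius `L` about `a` and stay away from `p`, so the
  -- clearance lemma applies.
  have hball {z : E} {s : ℝ} (hs : L / 2 ≤ s) (hsL : s ≤ L)
      (hz : dist z (A s) ≤ c * (L - s)) : z ∈ S i := by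
    refine (hS i _).2 fun j hj y hy => ?_
    have h1 := hcone L ((L - s) / L) (a - y) (a - p) hL0 (by linarith)
      (div_nonneg (by linarith) hL0.le) (by rw [div_le_iff₀ hL0]; linarith)
      (by rw [← dist_eq_norm]; exact (hS i a).1 haS j hj y hy)
      (by rw [← dist_eq_norm, ← hap])
      (by
        rw [sub_sub_sub_cancel_left, ← dist_eq_norm]
        exact hsep i j hj p hp y (hRS j hy))
    have h2 : a - y - ((L - s) / L) • (a - p) = A s - y := by
      rw [← hLw, smul_smul, div_mul_cancel₀ _ hL0.ne']
      simp only [hA, retreat]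
      abel
    rw [h2, ← dist_eq_norm, div_mul_cancel₀ _ hL0.ne', sub_mul, one_mul,
      div_mul_cancel₀ _ hL0.ne'] at h1
    have h3 : infDist z (P i) ≤ infDist (A s) (P i) + dist z (A s) := infDist_le_infDist_add_dist
    have h4 := hAD (s := s) (by linarith)
    have h5 := dist_triangle (A s) z y
    rw [dist_comm (A s) z] at h5
    linarith
  obtain ⟨l, ⟨⟨hl0, hlL⟩, hlR⟩, hlmax⟩ :
      ∃ l, IsGreatest (Set.Icc 0 L ∩ A ⁻¹' R i) l := by
    refine IsCompact.exists_isGreatest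
      (isCompact_Icc.inter_right ((hRc i).preimage (continuous_retreat a w L)))
      ⟨0, ⟨le_rfl, hL0.le⟩, ?_⟩
    rw [Set.mem_preimage, hA0]
    exact hPR i hp
  have hml : m ≤ l := by
    refine le_of_forall_lt_imp_le_of_dense fun s hs => ?_
    rcases lt_or_ge s 0 with hs0 | hs0
    · exact hs0.le.trans hl0
    · exact hlmax ⟨⟨hs0, by linarith⟩, hlow (hAS hs0 (by linarith)) ((hAD hs0).trans_lt hs)⟩
  have hlL' : l < L := by
    refine lt_of_le_of_ne hlL ?_
    rintro rfl
    rw [Set.mem_preimage, hAL] at hlR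
    exact haR hlR
  -- The overshoot is small enough that `(1 + c / 4) * (L - s)` still exceeds `(1 + c / 8) * (L -
  -- l)`.
  set s := l + c / 16 * (L - l) with hs
  have hgapL : 0 < L - l := by linarith
  have hcgap : 0 < c * (L - l) := by positivity
  have hls : l < s := by linarith
  have hsL : s < L := by nlinarith
  have hsD := hAD (s := s) (by linarith)
  have hsR : A s ∉ R i := fun h => absurd (hlmax ⟨⟨by linarith, hsL.le⟩, h⟩) (not_le.2 hls)
  have hsS : A s ∈ S i := hAS (by linarith) hsL.le
  obtain ⟨j, hj, b, hb, hbs⟩ :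
      ∃ j, j ≠ i ∧ ∃ b ∈ S j, dist (A s) b < infDist (A s) (P i) := by
    by_contra! hcon
    exact hsR ((hR i _).2 hcon)
  have hbR : b ∉ R j := fun h => absurd ((hS i _).1 hsS j hj b h) (not_le.2 hbs)
  have hbm : m ≤ infDist b (P j) := hgap j b hb hbR
  have hbl : infDist b (P j) ≤ dist b (A l) := (hS j b).1 hb i hj.symm _ hlR
  have hblr : dist b (A l) ≤ L := by
    have h1 := dist_triangle_left b (A l) (A s)
    rw [hAdist, abs_of_pos (by linarith)] at h1
    nlinarith
  set x := A s - b with hx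
  have hxA (t : ℝ) : x + t • w = A (s + t) - b := by
    simp only [hx, hA, retreat]
    module
  have hxA' (t : ℝ) : x - t • w = A (s - t) - b := by
    simp only [hx, hA, retreat]
    module
  have hxs : ‖x‖ < s := by
    rw [hx, ← dist_eq_norm]
    linarith
  -- The ball of radius `c * κ` about `A (s - κ)` lies in `R i`, hence at distance at least `m` from
  -- `b`. As `‖x‖ < s < m + c * κ / 2`, the average slope up to `s` is below `-c / 2`; smoothness
  -- costs only `c / 4` of it.
  have hleft : m + c * κ ≤ ‖x - κ • w‖ := by
    have hAR {z : E} (hz : dist z (A (s - κ)) ≤ c * κ) : z ∈ R i := by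
      have h1 : 0 ≤ c * (L - s) := mul_nonneg hc.le (by linarith)
      refine hlow (hball (s := s - κ) (by linarith) (by linarith) (by linarith)) ?_
      have h3 : infDist z (P i) ≤ infDist (A (s - κ)) (P i) + dist z (A (s - κ)) :=
        infDist_le_infDist_add_dist
      have h4 := hAD (s := s - κ) (by linarith)
      linarith
    have h1 : infDist b (P j) ≤ dist b (A (s - κ)) :=
      (hS j b).1 hb i hj.symm _ (hAR (by simpa using hcκ.le))
    obtain ⟨z, hz, hbz⟩ := exists_dist_add_eq hcκ.le (show c * κ ≤ dist b (A (s - κ)) by linarith)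
    have h2 : infDist b (P j) ≤ dist b z := (hS j b).1 hb i hj.symm z (hAR hz)
    rw [hxA', ← dist_eq_norm, dist_comm]
    linarith
  have hxlow : m / 2 ≤ ‖x‖ := by
    have h1 := norm_sub_le x (κ • w)
    rw [norm_smul, hw1, mul_one, Real.norm_of_nonneg hκ.le] at h1
    linarith
  have hab : dist a b ≤ s - c / 4 * (L - s) := by
    have h1 := norm_add_smul_le_of_second_difference (α := c / 2) (h := L - s) hκ (by linarith)
      (by linarith) (hκs x w hxlow (by linarith) hw1.le) (by linarith)
    rw [hxA, add_sub_cancel, hAL, ← dist_eq_norm] at h1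
    linarith
  refine ⟨j, b, hb, hbR, by linarith, ?_⟩
  refine (le_infDist ((hne j).mono (hPR j))).2 fun y hy => ?_
  have h1 : L ≤ dist a y := (hS i a).1 haS j hj y hy
  have h2 := dist_triangle a b y
  have h3 : infDist a (R i) ≤ L - l := by
    refine (infDist_le_dist_of_mem (show A l ∈ R i from hlR)).trans_eq ?_
    rw [← hAL, hAdist, abs_of_pos hgapL]
  have h4 : (1 + c / 8) * infDist a (R i) ≤ (1 + c / 8) * (L - l) :=
    mul_le_mul_of_nonneg_left h3 (by linarith)
  have h5 : L - s = (1 - c / 16) * (L - l) := by rw [hs]; ring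
  have h6 : (1 + c / 8) * (L - l) ≤ (1 + c / 4) * (L - s) := by
    rw [h5, ← mul_assoc]
    exact mul_le_mul_of_nonneg_right (by nlinarith) hgapL.le
  linarith

/-- A pair of tuples that the dominance map interchanges, one contained in the other, is a
zone diagram. -/
theorem eq_of_Dom_eq_of_Dom_eq [StrictConvexSpace ℝ E] (hsmooth : IsSmoothNorm E)
    (hne : ∀ i, (P i).Nonempty) (hclosed : ∀ i, IsClosed (P i))
    (hdist : ∀ i j, i ≠ j → 0 < setEDist (P i) (P j))
    (hDR : Dom P S = R) (hDS : Dom P R = S) (hle : R ≤ S) : R = S := by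
  have hR : ∀ i x, x ∈ R i ↔ ∀ j, j ≠ i → ∀ y ∈ S j, infDist x (P i) ≤ dist x y := by
    intro i x
    rw [← hDR]
    exact mem_Dom_iff hne
  have hS : ∀ i x, x ∈ S i ↔ ∀ j, j ≠ i → ∀ y ∈ R j, infDist x (P i) ≤ dist x y := by
    intro i x
    rw [← hDS]
    exact mem_Dom_iff hne
  have hPR : ∀ i, P i ⊆ R i := fun i x hx =>
    (hR i x).2 fun j _ y _ => by simp [infDist_zero_of_mem hx]
  have hRc : ∀ i, IsClosed (R i) := by
    intro i
    have : R i = ⋂ (j) (_ : j ≠ i), ⋂ y ∈ S j, {x | infDist x (P i) ≤ dist x y} := by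
      ext x
      simp [hR i x]
    rw [this]
    exact isClosed_iInter fun j => isClosed_iInter fun _ => isClosed_biInter fun y _ =>
      isClosed_le (continuous_infDist_pt _) (by fun_prop)
  obtain ⟨e, he, hPP⟩ := exists_pos_le_dist_of_setEDist_pos hdist
  -- `y` is at least as near to `P j` as to `x`, and `x` is at least `e` from `P j`.
  have hsep : ∀ i j, j ≠ i → ∀ x ∈ P i, ∀ y ∈ S j, e / 2 ≤ dist x y := by
    intro i j hj x hx y hy
    have h1 := (hS j y).1 hy i hj.symm x (hPR i hx)
    have h2 : e ≤ infDist x (P j) := (le_infDist (hne j)).2 fun z hz => hPP i j hj.symm x hx z hz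
    have h3 : infDist x (P j) ≤ infDist y (P j) + dist x y := infDist_le_infDist_add_dist
    rw [dist_comm y x] at h1
    linarith
  have hgap0 : ∀ i, ∀ x ∈ S i, x ∉ R i → e / 4 ≤ infDist x (P i) := by
    intro i x _ hxR
    by_contra! hlt
    refine hxR ((hR i x).2 fun j hj y hy => ?_)
    obtain ⟨p, hp, hxp⟩ := (infDist_lt_iff (hne i)).1 hlt
    have h1 := hsep i j hj p hp y hy
    have h2 := dist_triangle_left p y x
    linarith
  by_contra hcon
  obtain ⟨i₀, a₀, ha₀S, ha₀R⟩ : ∃ i, ∃ a ∈ S i, a ∉ R i := by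
    by_contra! h
    exact hcon (le_antisymm hle h)
  set D : Set ℝ := {d | ∃ i, ∃ a ∈ S i, a ∉ R i ∧ infDist a (P i) = d} with hD
  have hDne : D.Nonempty := ⟨_, i₀, a₀, ha₀S, ha₀R, rfl⟩
  have hDlow : e / 4 ∈ lowerBounds D := by
    rintro _ ⟨i, a, haS, haR, rfl⟩
    exact hgap0 i a haS haR
  have hm : 0 < sInf D := (by positivity : 0 < e / 4).trans_le (le_csInf hDne hDlow)
  obtain ⟨t, q, ht, hq, hstep⟩ := exists_gap_expansion hsmooth hne hclosed hR hS hle hPR hRc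
    (half_pos he) hm hsep fun i x hxS hxR => csInf_le ⟨_, hDlow⟩ ⟨i, x, hxS, hxR, rfl⟩
  obtain ⟨_, ⟨i₁, a₁, ha₁S, ha₁R, rfl⟩, ha₁⟩ :=
    exists_lt_of_csInf_lt hDne (show sInf D < sInf D + t by linarith)
  have hpos : 0 < infDist a₁ (R i₁) :=
    ((hRc i₁).notMem_iff_infDist_pos ((hne i₁).mono (hPR i₁))).1 ha₁R
  have hiter : ∀ k : ℕ, ∃ i, ∃ a ∈ S i, a ∉ R i ∧ infDist a (P i) ≤ sInf D + t ∧
      q ^ k * infDist a₁ (R i₁) ≤ infDist a (R i) := by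
    intro k
    induction k with
    | zero => exact ⟨i₁, a₁, ha₁S, ha₁R, ha₁.le, by simp⟩
    | succ k ih =>
      obtain ⟨i, a, haS, haR, haD, hak⟩ := ih
      obtain ⟨j, b, hbS, hbR, hbD, hb⟩ := hstep i a haS haR haD
      refine ⟨j, b, hbS, hbR, hbD, le_trans ?_ hb⟩
      rw [pow_succ', mul_assoc]
      exact mul_le_mul_of_nonneg_left hak (by linarith)
  obtain ⟨k, hk⟩ := pow_unbounded_of_one_lt ((sInf D + t) / infDist a₁ (R i₁)) hq
  obtain ⟨i, a, -, -, haD, hak⟩ := hiter k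
  rw [div_lt_iff₀ hpos] at hk
  have := infDist_le_infDist_of_subset (x := a) (hPR i) (hne i)
  linarith

end DoubleZoneDiagram

/-! ### Existence and uniqueness -/

theorem theorem2 {E : Type*} [NormedAddCommGroup E] [NormedSpace ℝ E] [FiniteDimensional ℝ E]
    [StrictConvexSpace ℝ E] (hsmooth : IsSmoothNorm E)
    {n : ℕ} (P : Fin n → Set E)
    (hne : ∀ i, (P i).Nonempty) (hclosed : ∀ i, IsClosed (P i))
    (hdist : ∀ i j, i ≠ j → 0 < setEDist (P i) (P j)) :
    ∃! R : Fin n → Set E, IsZoneDiagram P R := by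
  let F : (Fin n → Set E) →o (Fin n → Set E) :=
    ⟨fun R => Dom P (Dom P R), (Dom_antitone P).comp (Dom_antitone P)⟩
  have hfix : Dom P (Dom P F.lfp) = F.lfp := F.map_lfp
  -- `Dom` maps fixed points of its square to fixed points.
  have hle : F.lfp ≤ Dom P F.lfp := F.lfp_le (congrArg (Dom P) hfix).le
  have heq : F.lfp = Dom P F.lfp :=
    eq_of_Dom_eq_of_Dom_eq hsmooth hne hclosed hdist hfix rfl hle
  refine ⟨F.lfp, heq, fun Z hZ => ?_⟩
  have hZ' : Z = Dom P Z := hZ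
  have h1 : F.lfp ≤ Z := F.lfp_le (show Dom P (Dom P Z) ≤ Z by rw [← hZ', ← hZ'])
  refine le_antisymm ?_ h1
  calc Z = Dom P Z := hZ'
    _ ≤ Dom P F.lfp := Dom_antitone P h1
    _ = F.lfp := heq.symm
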